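/- Let $r\in[0,\infty)$ and $k\in\mathbb N_0$ be such that $\max\{k,r\}>0$. For integers $0\le k\le n$ define the $r$-Stirling numbers of the first and of the second kind by $$\genfrac{[}{]}{0pt}{}{n}{k}_r=\sum_{j=k}^n \genfrac{[}{]}{0pt}{}{n}{j}\binom{j}{k} r^{j-k},\qquad \genfrac{\{}{\}}{0pt}{}{n}{k}_r=\sum_{j=k}^n \binom{n}{j}\genfrac{\{}{\}}{0pt}{}{j}{k} r^{n-j},$$ where $\genfrac{[}{]}{0pt}{}{n}{j}$ and $\genfrac{\{}{\}}{0pt}{}{j}{k}$ are the (unsigned) Stirling numbers of the first and of the second kind and $0^0=1$. For $n\in\mathbb N$, $n\ge k$, let $\mathrm{Lah}(n,k)_r$ be a random variable with the $r$-Lah distribution $$\mathbb P[\mathrm{Lah}(n,k)_r=i]=\frac{1}{L(n,k)_r}\genfrac{[}{]}{0pt}{}{n}{i}_r\genfrac{\{}{\}}{0pt}{}{i}{k}_r,\quad i\in\{k,\dots,n\},\qquad L(n,k)_r=\sum_{j=k}^n\genfrac{[}{]}{0pt}{}{n}{j}_r\genfrac{\{}{\}}{0pt}{}{j}{k}_r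 .$$ Then there is $N\in\mathbb N$ (depending on $k$ and $r$) such that for all integers $n>N$, every maximizer of the function $i\mapsto\mathbb P[\mathrm{Lah}(n,k)_r=i]$ is one of the two numbers $$\left\lfloor (k+r)\log n-\frac{(k+r)\Gamma'(k+2r)}{\Gamma(k+2r)}-\frac12\right\rfloor,\qquad \left\lceil (k+r)\log n-\frac{(k+r)\Gamma'(k+2r)}{\Gamma(k+2r)}-\frac12\right\rceil .$$ -/

import Mathlib

/-- The `r`-Stirling number of the first kind `[n, k]_r` for real `r`, in the normalization in which,
for integer `r ≥ 0`, it counts the permutations of `{1, …, n + r}` with exactly `k + r` cycles such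
that `1, …, r` lie in distinct cycles. It vanishes for `k > n`. -/
noncomputable def rStirlingFirst (n k : ℕ) (r : ℝ) : ℝ :=
  ∑ j ∈ Finset.Icc k n, (Nat.stirlingFirst n j : ℝ) * (Nat.choose j k : ℝ) * r ^ (j - k)

/-- The `r`-Stirling number of the second kind `{n, k}_r` for real `r`, in the normalization in
which, for integer `r ≥ 0`, it counts the partitions of `{1, …, n + r}` into exactly `k + r`
nonempty blocks such that `1, …, r` lie in distinct blocks. It vanishes for `k > n`. -/
noncomputable def rStirlingSecond (n k : ℕ) (r : ℝ) : ℝ :=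
  ∑ j ∈ Finset.Icc k n, (Nat.choose n j : ℝ) * (Nat.stirlingSecond j k : ℝ) * r ^ (n - j)

/-- The `r`-Lah number `L(n, k)_r`. -/
noncomputable def rLah (n k : ℕ) (r : ℝ) : ℝ :=
  ∑ j ∈ Finset.Icc k n, rStirlingFirst n j r * rStirlingSecond j k r

/-- The probability mass function `i ↦ ℙ[Lah(n, k)_r = i]` of the `r`-Lah distribution; it is
supported on `{k, …, n}`. -/
noncomputable def rLahProb (n k : ℕ) (r : ℝ) (i : ℕ) : ℝ :=
  if i ∈ Finset.Icc k n then rStirlingFirst n i r * rStirlingSecond i k r / rLah n k r else 0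

theorem rStirlingFirst_nonneg (n k : ℕ) {r : ℝ} (hr : 0 ≤ r) : 0 ≤ rStirlingFirst n k r :=
  Finset.sum_nonneg fun _ _ => by positivity

theorem rStirlingSecond_nonneg (n k : ℕ) {r : ℝ} (hr : 0 ≤ r) : 0 ≤ rStirlingSecond n k r :=
  Finset.sum_nonneg fun _ _ => by positivity

theorem stirlingSecond_pos_of_le {n k : ℕ} (hk : 0 < k) (hkn : k ≤ n) :
    0 < Nat.stirlingSecond n k := by
  induction n, hkn using Nat.le_induction with
  | base => simp [Nat.stirlingSecond_self]
  | succ n _ ih =>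
    obtain ⟨m, rfl⟩ : ∃ m, k = m + 1 := ⟨k - 1, by omega⟩
    rw [Nat.stirlingSecond_succ_succ]
    positivity

/-- The normalizing constant is positive for every admissible triple of parameters. -/
theorem rLah_pos {n k : ℕ} {r : ℝ} (hkn : k ≤ n) (hr : 0 ≤ r) (hkr : 0 < max (k : ℝ) r) :
    0 < rLah n k r := by
  have h1 : 0 < rStirlingFirst n n r := by
    simp [rStirlingFirst, Nat.stirlingFirst_self]
  have h2 : 0 < rStirlingSecond n k r := by
    rcases Nat.eq_zero_or_pos k with rfl | hk
    · have hr' : 0 < r := by simpa using hkr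
      refine lt_of_lt_of_le (b := r ^ n) (by positivity) ?_
      have h := Finset.single_le_sum
        (f := fun j => (Nat.choose n j : ℝ) * (Nat.stirlingSecond j 0 : ℝ) * r ^ (n - j))
        (s := Finset.Icc 0 n) (fun j _ => by positivity) (Finset.mem_Icc.2 ⟨le_rfl, hkn⟩)
      simpa [rStirlingSecond] using h
    · have h := Finset.single_le_sum
        (f := fun j => (Nat.choose n j : ℝ) * (Nat.stirlingSecond j k : ℝ) * r ^ (n - j))
        (s := Finset.Icc k n) (fun j _ => by positivity) (Finset.mem_Icc.2 ⟨hkn, le_rfl⟩)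
      have h3 : (0 : ℝ) < Nat.stirlingSecond n k := by
        exact_mod_cast stirlingSecond_pos_of_le hk hkn
      refine lt_of_lt_of_le h3 ?_
      simpa [rStirlingSecond] using h
  have h := Finset.single_le_sum
    (f := fun j => rStirlingFirst n j r * rStirlingSecond j k r)
    (s := Finset.Icc k n)
    (fun j _ => mul_nonneg (rStirlingFirst_nonneg n j hr) (rStirlingSecond_nonneg j k hr))
    (Finset.mem_Icc.2 ⟨hkn, le_rfl⟩)
  exact lt_of_lt_of_le (mul_pos h1 h2) h

theorem rLahProb_nonneg (n k : ℕ) {r : ℝ} (hr : 0 ≤ r) (i : ℕ) : 0 ≤ rLahProb n k r i := by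
  unfold rLahProb
  split_ifs
  · exact div_nonneg (mul_nonneg (rStirlingFirst_nonneg n i hr) (rStirlingSecond_nonneg i k hr))
      (Finset.sum_nonneg fun j _ =>
        mul_nonneg (rStirlingFirst_nonneg n j hr) (rStirlingSecond_nonneg j k hr))
  · exact le_rfl

/-- For admissible parameters, `rLahProb n k r` is a probability mass function on `{k, …, n}`. -/
theorem sum_rLahProb {n k : ℕ} {r : ℝ} (hkn : k ≤ n) (hr : 0 ≤ r) (hkr : 0 < max (k : ℝ) r) :
    ∑ i ∈ Finset.Icc k n, rLahProb n k r i = 1 := by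
  have h : ∑ i ∈ Finset.Icc k n, rLahProb n k r i
      = ∑ i ∈ Finset.Icc k n, rStirlingFirst n i r * rStirlingSecond i k r / rLah n k r :=
    Finset.sum_congr rfl fun i hi => if_pos hi
  rw [h, ← Finset.sum_div]
  exact div_self (rLah_pos hkn hr hkr).ne'

/-! Write `a i` for `[n,i]_r`, the coefficients of `∏_{m<n} (X + r + m)`, and put `q = k + r`, `H =
∑_{m<n} 1/(r+m+q)`. The ratio `{i+1,k}_r / {i,k}_r` lies between `q` and `q` plus an exponentially
small error, so a maximizer sits essentially where `a i / a (i+1)` crosses `q`. Differentiating the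
product and using log-concavity of each product with one factor removed shows that `a i / a (i+1) ≥
q` forces `q H ≤ i + 1` (`sum_div_le_of_mul_coeff_succ_le`). The converse holds asymptotically: once
`j ≥ q H - 5/8`, the ratio exceeds `q` by more than the error (`eventually_add_mul_coeff_succ_lt`).
Since `H - log n → -ψ(k+2r)`, with `ψ = Γ'/Γ`, the number `u` inside floor and ceiling is eventually
within `1/8` of `q H - 1/2`. The two bounds then give `u - 1 < i < u + 1`. -/

open Polynomial Filter Topology

/-! ### Log-concavity and multiplication by linear factors -/

/-- Log-concavity of a sequence in the strong form that also excludes internal zeros of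
nonnegative sequences. -/
def StrongLogConcave (a : ℕ → ℝ) : Prop :=
  ∀ i j, i ≤ j → a i * a (j + 2) ≤ a (i + 1) * a (j + 1)

theorem StrongLogConcave.mul_X_add_C {b a : ℕ → ℝ} {s : ℝ} (hs : 0 ≤ s) (hb : StrongLogConcave b)
    (hb0 : ∀ i, 0 ≤ b i) (ha0 : a 0 = s * b 0) (ha : ∀ i, a (i + 1) = s * b (i + 1) + b i) :
    StrongLogConcave a := by
  intro i j hij
  rcases i with _ | i
  · rw [ha0, ha, ha, ha]
    have h1 := mul_le_mul_of_nonneg_left (hb 0 j hij) (mul_nonneg hs hs)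
    have h2 := mul_nonneg hs (mul_nonneg (hb0 1) (hb0 j))
    have h3 := mul_nonneg (hb0 0) (hb0 j)
    simp only [zero_add] at *
    linarith
  · obtain ⟨j, rfl⟩ : ∃ j', j = j' + 1 := ⟨j - 1, by omega⟩
    rw [ha, ha, ha, ha]
    have hij' : i ≤ j := by omega
    have h1 := mul_le_mul_of_nonneg_left (hb (i + 1) (j + 1) hij) (mul_nonneg hs hs)
    have h2 := hb i j hij'
    have h3 : b i * b (j + 3) ≤ b (i + 2) * b (j + 1) := by
      refine (hb i (j + 1) (by omega)).trans ?_
      rcases hij'.eq_or_lt with rfl | h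
      · exact (mul_comm _ _).le
      · exact hb (i + 1) j h
    have h4 := mul_le_mul_of_nonneg_left h3 hs
    simp only [add_assoc, Nat.reduceAdd] at *
    linarith

/-! ### Coefficient ratios of products of linear factors -/

section LinearFactors

variable {ι : Type*} [DecidableEq ι] (w : ι → ℝ) (s : Finset ι)

/-- The polynomial `∏ m ∈ s, (X + w m)`. -/
noncomputable def linProd : ℝ[X] := ∏ m ∈ s, (X + C (w m))

variable {w s}

theorem linProd_insert {m : ι} (hm : m ∉ s) :
    linProd w (insert m s) = linProd w s * (X + C (w m)) := by
  rw [linProd, Finset.prod_insert hm, mul_comm, linProd]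

theorem linProd_eq_erase {m : ι} (hm : m ∈ s) :
    linProd w s = linProd w (s.erase m) * (X + C (w m)) := by
  rw [← linProd_insert (Finset.notMem_erase m s), Finset.insert_erase hm]

theorem coeff_mul_X_add_C_zero (p : ℝ[X]) (c : ℝ) :
    (p * (X + C c)).coeff 0 = c * p.coeff 0 := by
  simp [mul_add, mul_comm]

theorem coeff_mul_X_add_C_succ (p : ℝ[X]) (c : ℝ) (i : ℕ) :
    (p * (X + C c)).coeff (i + 1) = c * p.coeff (i + 1) + p.coeff i := by
  simp [mul_add, add_comm, mul_comm]

theorem coeff_linProd_nonneg (hw : ∀ m, 0 ≤ w m) (i : ℕ) : 0 ≤ (linProd w s).coeff i := by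
  induction s using Finset.induction_on generalizing i with
  | empty => simp only [linProd, Finset.prod_empty, coeff_one]; split_ifs <;> norm_num
  | insert m s hm ih =>
    rw [linProd_insert hm]
    rcases i with _ | i
    · rw [coeff_mul_X_add_C_zero]; exact mul_nonneg (hw m) (ih 0)
    · rw [coeff_mul_X_add_C_succ]; exact add_nonneg (mul_nonneg (hw m) (ih _)) (ih _)

theorem strongLogConcave_coeff_linProd (hw : ∀ m, 0 ≤ w m) :
    StrongLogConcave (linProd w s).coeff := by
  induction s using Finset.induction_on with
  | empty => intro i j _; simp [linProd, coeff_one]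
  | insert m s hm ih =>
    rw [linProd_insert hm]
    exact ih.mul_X_add_C (hw m) (coeff_linProd_nonneg hw) (coeff_mul_X_add_C_zero _ _)
      (coeff_mul_X_add_C_succ _ _)

theorem succ_mul_coeff_linProd (i : ℕ) :
    ((i : ℝ) + 1) * (linProd w s).coeff (i + 1) = ∑ m ∈ s, (linProd w (s.erase m)).coeff i := by
  have h : derivative (linProd w s) = ∑ m ∈ s, linProd w (s.erase m) := by
    simp [linProd, derivative_prod_finset]
  rw [← finsetSum_coeff, ← h, coeff_derivative, mul_comm]

theorem coeff_erase_le_succ (hw : ∀ m, 0 ≤ w m) {m : ι} (hm : m ∈ s) (i : ℕ) :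
    (linProd w (s.erase m)).coeff i ≤ (linProd w s).coeff (i + 1) := by
  rw [linProd_eq_erase hm, coeff_mul_X_add_C_succ]
  exact le_add_of_nonneg_left (mul_nonneg (hw m) (coeff_linProd_nonneg hw _))

theorem mul_coeff_erase_le (hw : ∀ m, 0 ≤ w m) {m : ι} (hm : m ∈ s) (i : ℕ) :
    w m * (linProd w (s.erase m)).coeff i ≤ (linProd w s).coeff i := by
  rw [linProd_eq_erase hm]
  rcases i with _ | i
  · rw [coeff_mul_X_add_C_zero]
  · rw [coeff_mul_X_add_C_succ]
    exact le_add_of_nonneg_right (coeff_linProd_nonneg hw _)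

/-- With `b` the coefficients after removing factor `m`, the difference of the two sides is `b i ^ 2
- b (i-1) * b (i+1)`. It bounds one summand of `succ_mul_coeff_linProd` in terms of the ratio `a i /
a (i+1)`. -/
theorem coeff_erase_mul_le_sq (hw : ∀ m, 0 ≤ w m) {m : ι} (hm : m ∈ s) (i : ℕ) :
    (linProd w (s.erase m)).coeff (i + 1)
        * (w m * (linProd w s).coeff (i + 1) + (linProd w s).coeff i)
      ≤ (linProd w s).coeff (i + 1) ^ 2 := by
  rw [linProd_eq_erase hm]
  have hb0 := coeff_linProd_nonneg (s := s.erase m) hw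
  rcases i with _ | i
  · rw [coeff_mul_X_add_C_zero, coeff_mul_X_add_C_succ]
    have := mul_nonneg (hw m) (mul_nonneg (hb0 1) (hb0 0))
    simp only [zero_add]
    nlinarith [hb0 0]
  · have h := strongLogConcave_coeff_linProd (s := s.erase m) hw i i le_rfl
    rw [coeff_mul_X_add_C_succ, coeff_mul_X_add_C_succ]
    simp only [add_assoc, Nat.reduceAdd] at *
    linarith

/-- The difference of the sides is `w m * (b i ^ 2 - b (i-1) * b (i+1))`. In terms of `ρ = a i / a
(i+1)` it says `b i / a (i+1) ≥ ρ / (w m + ρ)`, which increases with `ρ`. -/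
theorem mul_le_coeff_erase_mul (hw : ∀ m, 0 ≤ w m) {m : ι} (hm : m ∈ s) (i : ℕ) :
    (linProd w s).coeff i * (linProd w s).coeff (i + 1)
      ≤ (linProd w (s.erase m)).coeff i
        * (w m * (linProd w s).coeff (i + 1) + (linProd w s).coeff i) := by
  rw [linProd_eq_erase hm]
  have hb0 := coeff_linProd_nonneg (s := s.erase m) hw
  rcases i with _ | i
  · rw [coeff_mul_X_add_C_zero, coeff_mul_X_add_C_succ]
    exact le_of_eq_of_le (by ring) (le_add_of_nonneg_right
      (mul_nonneg (hb0 0) (mul_nonneg (hw m) (hb0 0)))) |>.trans (mul_add _ _ _).ge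
  · have h := mul_le_mul_of_nonneg_left
      (strongLogConcave_coeff_linProd (s := s.erase m) hw i i le_rfl) (hw m)
    rw [coeff_mul_X_add_C_succ, coeff_mul_X_add_C_succ]
    simp only [add_assoc, Nat.reduceAdd] at *
    linarith

/-- If `c ≤ aᵢ / aᵢ₊₁`, then the mean number of successes for the odds `c / wₘ` is at most
`i + 1`. -/
theorem sum_div_le_of_mul_coeff_succ_le (hw : ∀ m, 0 ≤ w m) {c : ℝ} (hc : 0 < c) {i : ℕ}
    (hpos : 0 < (linProd w s).coeff (i + 1))
    (h : c * (linProd w s).coeff (i + 1) ≤ (linProd w s).coeff i) :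
    c * ∑ m ∈ s, 1 / (w m + c) ≤ i + 1 := by
  refine le_of_mul_le_mul_right ?_ hpos
  rw [succ_mul_coeff_linProd, Finset.mul_sum, Finset.sum_mul]
  refine Finset.sum_le_sum fun m hm => ?_
  have hwc : 0 < w m + c := add_pos_of_nonneg_of_pos (hw m) hc
  rw [mul_one_div, div_mul_eq_mul_div, div_le_iff₀ hwc]
  have h1 := mul_le_coeff_erase_mul hw hm i
  have h2 := mul_nonneg (hw m) (coeff_linProd_nonneg (s := s.erase m) hw i)
  set A := (linProd w s).coeff (i + 1)
  set B := (linProd w s).coeff i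
  set b := (linProd w (s.erase m)).coeff i
  have h3 := mul_nonneg h2 (sub_nonneg.2 h)
  have h4 := mul_le_mul_of_nonneg_left h1 hc.le
  refine le_of_mul_le_mul_right ?_ ((mul_pos hc hpos).trans_le h)
  linarith

theorem succ_mul_coeff_succ_le (hw : ∀ m, 0 ≤ w m) {t : ℝ} (ht : 0 < t) {i : ℕ}
    (hpos : 0 < (linProd w s).coeff (i + 1))
    (h : t * (linProd w s).coeff (i + 1) ≤ (linProd w s).coeff i) :
    ((i : ℝ) + 2) * (linProd w s).coeff (i + 2)
      ≤ (linProd w s).coeff (i + 1) * ∑ m ∈ s, 1 / (w m + t) := by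
  have h0 := succ_mul_coeff_linProd (w := w) (s := s) (i + 1)
  push_cast at h0
  rw [show (i : ℝ) + 2 = i + 1 + 1 by ring, h0, Finset.mul_sum]
  refine Finset.sum_le_sum fun m hm => ?_
  have hwt : 0 < w m + t := add_pos_of_nonneg_of_pos (hw m) ht
  rw [mul_one_div, le_div_iff₀ hwt]
  have h1 := coeff_erase_mul_le_sq hw hm i
  have h2 := mul_le_mul_of_nonneg_left h (coeff_linProd_nonneg (s := s.erase m) hw (i + 1))
  refine le_of_mul_le_mul_right ?_ hpos
  linarith

/-- A crude a priori ratio bound. The factor `m₀`, whose weight may vanish (`r = 0`, `m = 0`), is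
paid for with one of the `i + 1` copies of `a (i+1)`. -/
theorem mul_coeff_succ_le_of_erase (hw : ∀ m, 0 ≤ w m) {m₀ : ι} (hm₀ : m₀ ∈ s)
    (hw' : ∀ m, m ≠ m₀ → 0 < w m) (i : ℕ) :
    (i : ℝ) * (linProd w s).coeff (i + 1)
      ≤ (linProd w s).coeff i * ∑ m ∈ s.erase m₀, 1 / w m := by
  have h0 := succ_mul_coeff_linProd (w := w) (s := s) i
  rw [← Finset.add_sum_erase _ _ hm₀] at h0
  have h1 := coeff_erase_le_succ hw hm₀ i
  have h2 : ∑ m ∈ s.erase m₀, (linProd w (s.erase m)).coeff i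
      ≤ (linProd w s).coeff i * ∑ m ∈ s.erase m₀, 1 / w m := by
    rw [Finset.mul_sum]
    refine Finset.sum_le_sum fun m hm => ?_
    rw [mul_one_div, le_div_iff₀ (hw' m (Finset.ne_of_mem_erase hm)), mul_comm]
    exact mul_coeff_erase_le hw (Finset.mem_of_mem_erase hm) i
  linarith

end LinearFactors

/-! ### Digamma function and harmonic-type sums -/

theorem hasDerivAt_log_Gamma {x : ℝ} (hx : 0 < x) :
    HasDerivAt (fun y => Real.log (Real.Gamma y)) (deriv Real.Gamma x / Real.Gamma x) x := by
  have hd : DifferentiableAt ℝ Real.Gamma x := Real.differentiableAt_Gamma fun m => by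
    have : (0 : ℝ) ≤ m := m.cast_nonneg
    linarith
  exact hd.hasDerivAt.log (Real.Gamma_pos_of_pos hx).ne'

theorem digamma_add_one {x : ℝ} (hx : 0 < x) :
    deriv Real.Gamma (x + 1) / Real.Gamma (x + 1)
      = deriv Real.Gamma x / Real.Gamma x + 1 / x := by
  have h1 := (hasDerivAt_log_Gamma (x := x + 1) (by linarith)).comp_add_const x 1
  have h2 := (hasDerivAt_log_Gamma hx).add (Real.hasDerivAt_log hx.ne')
  rw [one_div]
  refine h1.unique (h2.congr_of_eventuallyEq ?_)
  filter_upwards [lt_mem_nhds hx] with y hy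
  simp only [Pi.add_apply]
  rw [Real.Gamma_add_one hy.ne', Real.log_mul hy.ne' (Real.Gamma_pos_of_pos hy).ne', add_comm]

theorem digamma_add_nat {x : ℝ} (hx : 0 < x) (n : ℕ) :
    deriv Real.Gamma (x + n) / Real.Gamma (x + n)
      = deriv Real.Gamma x / Real.Gamma x + ∑ m ∈ Finset.range n, 1 / (x + m) := by
  induction n with
  | zero => simp
  | succ n ih =>
    rw [Finset.sum_range_succ, ← add_assoc, ← ih, Nat.cast_succ, ← add_assoc,
      digamma_add_one (by positivity)]

theorem log_Gamma_add_one_sub {x : ℝ} (hx : 0 < x) :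
    Real.log (Real.Gamma (x + 1)) - Real.log (Real.Gamma x) = Real.log x := by
  rw [Real.Gamma_add_one hx.ne', Real.log_mul hx.ne' (Real.Gamma_pos_of_pos hx).ne']
  ring

theorem digamma_le_log {x : ℝ} (hx : 0 < x) :
    deriv Real.Gamma x / Real.Gamma x ≤ Real.log x := by
  have h := Real.convexOn_log_Gamma.le_slope_of_hasDerivAt (x := x) (y := x + 1) hx
    (by simp only [Set.mem_Ioi]; linarith) (by linarith) (hasDerivAt_log_Gamma hx)
  simpa [slope_def_field, log_Gamma_add_one_sub hx] using h

theorem log_le_digamma_add_one {x : ℝ} (hx : 0 < x) :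
    Real.log x ≤ deriv Real.Gamma (x + 1) / Real.Gamma (x + 1) := by
  have h := Real.convexOn_log_Gamma.slope_le_of_hasDerivAt (x := x) (y := x + 1) hx
    (by simp only [Set.mem_Ioi]; linarith) (by linarith)
    (hasDerivAt_log_Gamma (x := x + 1) (by linarith))
  simpa [slope_def_field, log_Gamma_add_one_sub hx] using h

theorem tendsto_log_add_nat_sub_log (x : ℝ) :
    Tendsto (fun n : ℕ => Real.log (x + n) - Real.log n) atTop (𝓝 0) := by
  have h1 : Tendsto (fun n : ℕ => x / (n : ℝ) + 1) atTop (𝓝 (0 + 1)) :=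
    (tendsto_const_div_atTop_nhds_zero_nat x).add_const 1
  rw [zero_add] at h1
  have h2 := h1.log one_ne_zero
  rw [Real.log_one] at h2
  refine h2.congr' ?_
  filter_upwards [eventually_gt_atTop 0,
    (tendsto_natCast_atTop_atTop (R := ℝ)).eventually_gt_atTop (-x)] with n hn hxn
  have hn' : (0 : ℝ) < n := by exact_mod_cast hn
  rw [← Real.log_div (by linarith) hn'.ne', add_div, div_self hn'.ne']

/-- The sum telescopes to `ψ(x+n) - ψ(x)`, and log-convexity of `Γ` squeezes `ψ(x+n)` between
`log(x+n-1)` and `log(x+n)`. -/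
theorem tendsto_sum_inv_sub_log {x : ℝ} (hx : 0 < x) :
    Tendsto (fun n : ℕ => ∑ m ∈ Finset.range n, 1 / (x + m) - Real.log n) atTop
      (𝓝 (-(deriv Real.Gamma x / Real.Gamma x))) := by
  have key : Tendsto (fun n : ℕ => deriv Real.Gamma (x + n) / Real.Gamma (x + n) - Real.log n)
      atTop (𝓝 0) := by
    refine tendsto_of_tendsto_of_tendsto_of_le_of_le' (tendsto_log_add_nat_sub_log (x - 1))
      (tendsto_log_add_nat_sub_log x) ?_ ?_
    · filter_upwards [eventually_ge_atTop 1] with n hn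
      have hn' : (1 : ℝ) ≤ n := by exact_mod_cast hn
      have := log_le_digamma_add_one (x := x - 1 + n) (by linarith)
      rw [show x - 1 + (n : ℝ) + 1 = x + n by ring] at this
      linarith
    · exact Eventually.of_forall fun n =>
        sub_le_sub_right (digamma_le_log (by positivity)) _
  have := key.sub_const (deriv Real.Gamma x / Real.Gamma x)
  rw [zero_sub] at this
  refine this.congr fun n => ?_
  rw [digamma_add_nat hx]
  ring

/-! ### Stirling numbers of the first kind as coefficients -/

theorem coeff_prod_range_X_add_C_natCast (n j : ℕ) :
    (∏ m ∈ Finset.range n, ((X : ℝ[X]) + C (m : ℝ))).coeff j = (Nat.stirlingFirst n j : ℝ) := by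
  induction n generalizing j with
  | zero => rcases j with _ | j <;> simp [coeff_one]
  | succ n ih =>
    rw [Finset.prod_range_succ]
    rcases j with _ | j
    · rw [coeff_mul_X_add_C_zero, ih, Nat.stirlingFirst_succ_zero]
      rcases n with _ | n <;> simp
    · rw [coeff_mul_X_add_C_succ, ih, ih, Nat.stirlingFirst_succ_succ]
      push_cast
      ring

theorem prod_range_X_add_C_natCast (n : ℕ) :
    ∏ m ∈ Finset.range n, ((X : ℝ[X]) + C (m : ℝ))
      = ∑ j ∈ Finset.range (n + 1), C (Nat.stirlingFirst n j : ℝ) * X ^ j := by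
  ext j
  rw [coeff_prod_range_X_add_C_natCast]
  simp only [finsetSum_coeff, coeff_C_mul_X_pow, Finset.sum_ite_eq, Finset.mem_range]
  split_ifs with h
  · rfl
  · rw [Nat.stirlingFirst_eq_zero_of_lt (by omega), Nat.cast_zero]

theorem coeff_linProd_range (n i : ℕ) (r : ℝ) :
    (linProd (fun m : ℕ => r + m) (Finset.range n)).coeff i = rStirlingFirst n i r := by
  have h : linProd (fun m : ℕ => r + m) (Finset.range n)
      = (∏ m ∈ Finset.range n, ((X : ℝ[X]) + C (m : ℝ))).comp (X + C r) := by
    rw [linProd, Polynomial.prod_comp]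
    refine Finset.prod_congr rfl fun m _ => ?_
    simp only [map_add, add_comp, X_comp, C_comp]
    ring
  rw [h, prod_range_X_add_C_natCast]
  simp only [Polynomial.sum_comp, mul_comp, C_comp, X_pow_comp, finsetSum_coeff, coeff_C_mul,
    coeff_X_add_C_pow, rStirlingFirst]
  symm
  refine Finset.sum_subset_zero_on_sdiff (fun j hj => ?_) (fun j hj => ?_) (fun j _ => by ring)
  · simp only [Finset.mem_Icc, Finset.mem_range] at *; omega
  · simp only [Finset.mem_sdiff, Finset.mem_Icc, Finset.mem_range] at hj
    rw [Nat.choose_eq_zero_of_lt (by omega)]; simp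

theorem stirlingFirst_pos {n i : ℕ} (hi : 1 ≤ i) (hin : i ≤ n) : 0 < Nat.stirlingFirst n i := by
  induction n generalizing i with
  | zero => omega
  | succ n ih =>
    obtain ⟨i, rfl⟩ : ∃ i', i = i' + 1 := ⟨i - 1, by omega⟩
    rw [Nat.stirlingFirst_succ_succ]
    rcases hin.eq_or_lt with h | h
    · obtain rfl : i = n := by omega
      rw [Nat.stirlingFirst_self]
      omega
    · have := ih hi (by omega)
      have : 0 < n := by omega
      positivity

theorem rStirlingFirst_pos {n i : ℕ} {r : ℝ} (hr : 0 ≤ r) (hi : 1 ≤ i) (hin : i ≤ n) :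
    0 < rStirlingFirst n i r := by
  refine Finset.sum_pos' (fun j _ => by positivity) ⟨i, Finset.mem_Icc.2 ⟨le_rfl, hin⟩, ?_⟩
  simpa using stirlingFirst_pos hi hin

/-! ### Growth of Stirling numbers of the second kind -/

theorem rStirlingSecond_eq_sum_range (n k : ℕ) (r : ℝ) :
    rStirlingSecond n k r = ∑ j ∈ Finset.range (n + 1),
      (Nat.choose n j : ℝ) * (Nat.stirlingSecond j k : ℝ) * r ^ (n - j) := by
  refine Finset.sum_subset_zero_on_sdiff (fun j hj => ?_) (fun j hj => ?_) (fun j _ => rfl)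
  · simp only [Finset.mem_Icc, Finset.mem_range] at *; omega
  · simp only [Finset.mem_sdiff, Finset.mem_Icc, Finset.mem_range] at hj
    rw [Nat.stirlingSecond_eq_zero_of_lt (by omega)]; simp

theorem rStirlingSecond_succ_aux (n k : ℕ) (r : ℝ) :
    rStirlingSecond (n + 1) k r = r * rStirlingSecond n k r
      + ∑ j ∈ Finset.range (n + 1),
        (Nat.choose n j : ℝ) * (Nat.stirlingSecond (j + 1) k : ℝ) * r ^ (n - j) := by
  rw [rStirlingSecond_eq_sum_range, Finset.sum_range_succ', rStirlingSecond_eq_sum_range,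
    Finset.mul_sum]
  simp only [Nat.choose_succ_succ, Nat.cast_add, add_mul, Finset.sum_add_distrib,
    Nat.add_sub_add_right]
  rw [add_assoc, add_comm, add_left_inj, Finset.sum_range_succ, Finset.sum_range_succ' _ n]
  simp only [Nat.choose_succ_self, Nat.cast_zero, zero_mul, add_zero, Nat.sub_zero,
    Nat.choose_zero_right, Nat.cast_one, one_mul, pow_succ]
  congr 1
  · refine Finset.sum_congr rfl fun j hj => ?_
    rw [show n - j = n - (j + 1) + 1 by have := Finset.mem_range.1 hj; omega, pow_succ]
    ring
  · ring

theorem rStirlingSecond_succ_zero (n : ℕ) (r : ℝ) :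
    rStirlingSecond (n + 1) 0 r = r * rStirlingSecond n 0 r := by
  rw [rStirlingSecond_succ_aux]
  simp

theorem rStirlingSecond_succ_succ (n k : ℕ) (r : ℝ) :
    rStirlingSecond (n + 1) (k + 1) r
      = rStirlingSecond n k r + ((k : ℝ) + 1 + r) * rStirlingSecond n (k + 1) r := by
  rw [rStirlingSecond_succ_aux, rStirlingSecond_eq_sum_range n k,
    rStirlingSecond_eq_sum_range n (k + 1), add_mul, add_comm _ (r * _), ← add_assoc,
    add_comm _ (r * _), add_assoc, add_right_inj, Finset.mul_sum, ← Finset.sum_add_distrib]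
  refine Finset.sum_congr rfl fun j _ => ?_
  rw [Nat.stirlingSecond_succ_succ]
  push_cast
  ring

theorem rStirlingSecond_self (k : ℕ) (r : ℝ) : rStirlingSecond k k r = 1 := by
  simp [rStirlingSecond, Nat.stirlingSecond_self]

theorem rStirlingSecond_zero_right (n : ℕ) (r : ℝ) : rStirlingSecond n 0 r = r ^ n := by
  induction n with
  | zero => exact rStirlingSecond_self 0 r
  | succ n ih => rw [rStirlingSecond_succ_zero, ih, pow_succ']

theorem mul_rStirlingSecond_le_succ (n k : ℕ) {r : ℝ} (hr : 0 ≤ r) :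
    ((k : ℝ) + r) * rStirlingSecond n k r ≤ rStirlingSecond (n + 1) k r := by
  rcases k with _ | k
  · rw [rStirlingSecond_succ_zero]; simp
  · rw [rStirlingSecond_succ_succ]
    push_cast
    exact le_add_of_nonneg_left (rStirlingSecond_nonneg n k hr)

theorem pow_le_rStirlingSecond (k m : ℕ) {r : ℝ} (hr : 0 ≤ r) :
    ((k : ℝ) + r) ^ m ≤ rStirlingSecond (k + m) k r := by
  induction m with
  | zero => simp [rStirlingSecond_self]
  | succ m ih =>
    rw [pow_succ']
    exact (mul_le_mul_of_nonneg_left ih (by positivity)).trans (mul_rStirlingSecond_le_succ _ _ hr)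

theorem rStirlingSecond_le_pow (n k : ℕ) {r : ℝ} (hr : 0 ≤ r) :
    rStirlingSecond n k r ≤ ((k : ℝ) + r) ^ n := by
  induction k generalizing n with
  | zero => simp [rStirlingSecond_zero_right]
  | succ k ihk =>
    -- The subtracted power absorbs the term `{n,k}_r` of the recurrence, so the induction on `n`
    -- closes.
    suffices h : rStirlingSecond n (k + 1) r ≤ ((k : ℝ) + 1 + r) ^ n - ((k : ℝ) + r) ^ n by
      push_cast
      exact h.trans (sub_le_self _ (by positivity))
    induction n with
    | zero => simp [rStirlingSecond]
    | succ n ihn =>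
      rw [rStirlingSecond_succ_succ]
      have h1 := ihk n
      have h2 := mul_le_mul_of_nonneg_left ihn (show 0 ≤ (k : ℝ) + 1 + r by positivity)
      rw [pow_succ', pow_succ']
      linarith

/-- The ratio of consecutive `r`-Stirling numbers of the second kind approaches `k + r`
faster than `1 / j`. -/
theorem exists_rStirlingSecond_succ_le (k : ℕ) {r : ℝ} (hr : 0 ≤ r) :
    ∃ ε : ℕ → ℝ, (∀ j, 0 ≤ ε j) ∧ Tendsto (fun j : ℕ => ((j : ℝ) + 1) * ε j) atTop (𝓝 0) ∧
      ∀ j, k ≤ j → rStirlingSecond (j + 1) k r ≤ ((k : ℝ) + r + ε j) * rStirlingSecond j k r := by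
  rcases k with _ | k
  · refine ⟨fun _ => 0, fun _ => le_rfl, by simp, fun j _ => ?_⟩
    rw [rStirlingSecond_succ_zero]; simp
  · have hq : 0 < (k : ℝ) + 1 + r := by positivity
    set ρ := ((k : ℝ) + r) / (k + 1 + r) with hρ
    have hρ0 : 0 ≤ ρ := by positivity
    have hρ1 : ρ < 1 := by rw [hρ, div_lt_one hq]; linarith
    -- The excess is `{j,k}_r / {j,k+1}_r`, at most `(k+r)^j / (k+1+r)^(j-k-1)`.
    refine ⟨fun j => ((k : ℝ) + 1 + r) ^ (k + 1) * ρ ^ j, fun j => by positivity, ?_,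
      fun j hj => ?_⟩
    · have h1 := tendsto_self_mul_const_pow_of_lt_one hρ0 hρ1
      have h2 := tendsto_pow_atTop_nhds_zero_of_lt_one hρ0 hρ1
      have h3 := (h1.add h2).const_mul (((k : ℝ) + 1 + r) ^ (k + 1))
      rw [add_zero, mul_zero] at h3
      refine h3.congr fun j => by ring
    · obtain ⟨m, rfl⟩ := Nat.exists_eq_add_of_le hj
      have h1 := pow_le_rStirlingSecond (k + 1) m hr
      have h2 := rStirlingSecond_le_pow (k + 1 + m) k hr
      rw [rStirlingSecond_succ_succ]
      push_cast at *
      have h3 : ((k : ℝ) + r) ^ (k + 1 + m)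
          = ((k : ℝ) + 1 + r) ^ (k + 1) * ρ ^ (k + 1 + m) * ((k : ℝ) + 1 + r) ^ m := by
        have h4 := pow_add ((k : ℝ) + 1 + r) (k + 1) m
        rw [hρ, div_pow, mul_right_comm, ← h4, mul_div_cancel₀ _ (by positivity)]
      have h4 := mul_le_mul_of_nonneg_left h1
        (show 0 ≤ ((k : ℝ) + 1 + r) ^ (k + 1) * ρ ^ (k + 1 + m) by positivity)
      linarith

/-! ### Ratios of first-kind numbers above the mean -/

/-- Each term changes by `d / (a m * (a m + d))`, which is summable, so the cost of the shift is
uniform in `s`. -/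
theorem sum_inv_le_sum_inv_add {s : Finset ℕ} {a : ℕ → ℝ} {c d : ℝ} (hc : 0 < c) (hd : 0 ≤ d)
    (ha : ∀ m ∈ s, c * (m + 1) ≤ a m) :
    ∑ m ∈ s, 1 / a m
      ≤ ∑ m ∈ s, 1 / (a m + d) + d * (c⁻¹ ^ 2 * ∑' m : ℕ, 1 / ((m : ℝ) + 1) ^ 2) := by
  have hsum : Summable fun m : ℕ => 1 / ((m : ℝ) + 1) ^ 2 := by
    have := (summable_nat_add_iff 1).2 (Real.summable_one_div_nat_pow.2 one_lt_two)
    simpa using this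
  have h1 := hsum.sum_le_tsum s fun m _ => by positivity
  have h2 := mul_le_mul_of_nonneg_left h1 (show 0 ≤ d * c⁻¹ ^ 2 by positivity)
  rw [mul_assoc, mul_assoc] at h2
  refine le_trans ?_ (add_le_add_right h2 _)
  rw [← mul_assoc, Finset.mul_sum, ← Finset.sum_add_distrib]
  refine Finset.sum_le_sum fun m hm => ?_
  have hcm : 0 < c * ((m : ℝ) + 1) := by positivity
  have ham : 0 < a m := hcm.trans_le (ha m hm)
  have h3 : 1 / a m - 1 / (a m + d) = d * (1 / (a m * (a m + d))) := by
    field_simp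
    ring
  have h4 : 1 / (a m * (a m + d)) ≤ 1 / (c * ((m : ℝ) + 1)) ^ 2 := by
    refine one_div_le_one_div_of_le (by positivity) ?_
    rw [sq]
    exact mul_le_mul (ha m hm) ((ha m hm).trans (le_add_of_nonneg_right hd)) hcm.le ham.le
  have h5 := mul_le_mul_of_nonneg_left h4 hd
  have h6 : d * c⁻¹ ^ 2 * (1 / ((m : ℝ) + 1) ^ 2) = d * (1 / (c * ((m : ℝ) + 1)) ^ 2) := by
    field_simp
  linarith

theorem mul_sum_inv_add_le {r q : ℝ} (hr : 0 ≤ r) (hq : 0 < q) (n : ℕ) :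
    q * ∑ m ∈ Finset.range n, 1 / (r + m + q) ≤ n := by
  rw [Finset.mul_sum]
  refine (Finset.sum_le_card_nsmul _ _ 1 fun m _ => ?_).trans (by simp)
  rw [mul_one_div, div_le_one (by positivity)]
  have : (0 : ℝ) ≤ r + m := by positivity
  linarith

/-- Above the mean, the ratios of consecutive coefficients of `(x + r) ⋯ (x + r + n - 1)` exceed `q`
by more than any perturbation that is negligible compared with `1 / j`. -/
theorem eventually_add_mul_coeff_succ_lt {r q : ℝ} (hr : 0 ≤ r) (hq : 0 < q) {ε : ℕ → ℝ}
    (hε : ∀ j, 0 ≤ ε j) (hε' : Tendsto (fun j : ℕ => ((j : ℝ) + 1) * ε j) atTop (𝓝 0))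
    (hH : Tendsto (fun n : ℕ => ∑ m ∈ Finset.range n, 1 / (r + m + q)) atTop atTop) :
    ∀ᶠ n : ℕ in atTop, ∀ j : ℕ,
      q * ∑ m ∈ Finset.range n, 1 / (r + m + q) - 5 / 8 ≤ j →
      0 < rStirlingFirst n j r → 0 < rStirlingFirst n (j + 1) r →
      (q + ε j) * rStirlingFirst n (j + 1) r < rStirlingFirst n j r := by
  set T := ∑' m : ℕ, 1 / ((m : ℝ) + 1) ^ 2
  have hT : 0 ≤ T := tsum_nonneg fun m => by positivity
  set K₁ := q * ((1 / 2 : ℝ)⁻¹ ^ 2 * T) with hK₁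
  set c := min 1 (q / 2)
  have hc : 0 < c := lt_min one_pos (by positivity)
  set K₂ := c⁻¹ ^ 2 * T with hK₂
  have hK₁0 : 0 ≤ K₁ := by positivity
  have hK₂0 : 0 ≤ K₂ := by positivity
  have hη : Tendsto (fun n : ℕ => (2 + q * K₁) / (∑ m ∈ Finset.range n, 1 / (r + m + q) + K₁))
      atTop (𝓝 0) := (tendsto_atTop_add_const_right _ K₁ hH).const_div_atTop _
  have hη₁ : ∀ᶠ n : ℕ in atTop,
      (2 + q * K₁) / (∑ m ∈ Finset.range n, 1 / (r + m + q) + K₁) < q / 2 :=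
    hη.eventually_lt_const (by positivity)
  have hη₂ : ∀ᶠ n : ℕ in atTop,
      q * K₂ * ((2 + q * K₁) / (∑ m ∈ Finset.range n, 1 / (r + m + q) + K₁)) < 1 / 8 := by
    have := hη.const_mul (q * K₂)
    rw [mul_zero] at this
    exact this.eventually_lt_const (by norm_num)
  obtain ⟨J, hJ⟩ := eventually_atTop.1
    (hε'.eventually_lt_const (show (0 : ℝ) < q / 8 by positivity))
  filter_upwards [hη₁, hη₂, hH.eventually_ge_atTop (((J : ℝ) + 3) / q), eventually_gt_atTop 0]
    with n h1 h2 h3 hn j hj ha ha'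
  set H := ∑ m ∈ Finset.range n, 1 / (r + m + q)
  -- Chosen so that `(q - η) * (H + K₁) = q * H - 2`, which is below `i = j - 1`.
  set η := (2 + q * K₁) / (H + K₁) with hηdef
  rw [div_le_iff₀ hq] at h3
  have hJ0 : (0 : ℝ) ≤ J := J.cast_nonneg
  have hHpos : 0 < H := by
    by_contra! h
    nlinarith
  have hη0 : 0 ≤ η := by positivity
  have hjJ : (J : ℝ) + 1 ≤ j := by linarith
  have hjJ' : J + 1 ≤ j := by exact_mod_cast hjJ
  obtain ⟨i, rfl⟩ : ∃ i, j = i + 1 := ⟨j - 1, by omega⟩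
  have hw : ∀ m : ℕ, 0 ≤ r + (m : ℝ) := fun m => by positivity
  -- Bootstrap: the crude bound gives `a i / a (i+1) ≥ q - η`; fed into the sharp bound, this and
  -- `hcon` yield `i + 2 ≤ (q + ε) * (H + η * K₂) < q * H + 3/8`, against `j = i + 1 ≥ q * H - 5/8`.
  by_contra! hcon
  rw [← coeff_linProd_range, ← coeff_linProd_range] at hcon
  rw [← coeff_linProd_range] at ha ha'
  set a := (linProd (fun m : ℕ => r + m) (Finset.range n)).coeff
  have hai : 0 ≤ a i := coeff_linProd_nonneg hw i
  have e1 : (i : ℝ) * a (i + 1) ≤ a i * (H + K₁) := by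
    refine (mul_coeff_succ_le_of_erase hw (Finset.mem_range.2 hn) (fun m hm => ?_) i).trans
      (mul_le_mul_of_nonneg_left ?_ hai)
    · have : (0 : ℝ) < m := by exact_mod_cast Nat.pos_of_ne_zero hm
      positivity
    · refine (sum_inv_le_sum_inv_add (c := 1 / 2) (d := q) (by norm_num) hq.le ?_).trans
        (add_le_add_left (Finset.sum_le_sum_of_subset_of_nonneg (Finset.erase_subset _ _)
          fun m _ _ => by positivity) _)
      intro m hm
      have : (1 : ℝ) ≤ m := by
        exact_mod_cast Nat.one_le_iff_ne_zero.2 (Finset.ne_of_mem_erase hm)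
      linarith
  have hηK : η * (H + K₁) = 2 + q * K₁ := div_mul_cancel₀ _ (by positivity)
  push_cast at hj hjJ
  have e2 : (q - η) * a (i + 1) ≤ a i := by
    refine le_of_mul_le_mul_right (le_trans ?_ e1) (show 0 < H + K₁ by positivity)
    rw [mul_right_comm]
    refine mul_le_mul_of_nonneg_right ?_ ha.le
    rw [sub_mul, hηK]
    linarith
  have e3 := succ_mul_coeff_succ_le hw (show 0 < q - η by linarith) ha e2
  have e4 : ∑ m ∈ Finset.range n, 1 / (r + m + (q - η)) ≤ H + η * K₂ := by
    refine (sum_inv_le_sum_inv_add hc hη0 fun m _ => ?_).trans_eq ?_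
    · have hc1 := mul_le_mul_of_nonneg_right (min_le_left 1 (q / 2)) (m.cast_nonneg (α := ℝ))
      have hc2 := min_le_right 1 (q / 2)
      simp only [c]
      linarith
    · congr 1
      refine Finset.sum_congr rfl fun m _ => ?_
      rw [add_assoc _ (q - η), sub_add_cancel]
  have e5 : ((i : ℝ) + 2) * a (i + 2) ≤ (q + ε (i + 1)) * (H + η * K₂) * a (i + 2) := by
    refine e3.trans ((mul_le_mul hcon e4 (Finset.sum_nonneg fun m _ => ?_) ?_).trans_eq (by ring))
    · have := hw m
      have : 0 < q - η := by linarith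
      positivity
    · exact mul_nonneg (add_nonneg hq.le (hε _)) ha'.le
  have e6 := le_of_mul_le_mul_right e5 ha'
  have e7 := hJ (i + 1) (by omega)
  push_cast at e7
  have e8 : q * (ε (i + 1) * (H + η * K₂)) ≤ q * (1 / 4) := by
    have : q * (H + η * K₂) ≤ (i + 1 + 1) + 1 / 8 := by linarith
    have h8 := mul_le_mul_of_nonneg_left this (hε (i + 1))
    have h9 := mul_nonneg (show (0 : ℝ) ≤ i by positivity) (hε (i + 1))
    have := hε (i + 1)
    linarith
  have e9 := le_of_mul_le_mul_left e8 hq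
  linarith

/-! ### Locating the maximizers -/

theorem pos_of_forall_rLahProb_le {k n i : ℕ} {r : ℝ} (hkn : k ≤ n) (hr : 0 ≤ r)
    (hkr : 0 < max (k : ℝ) r) (hi : ∀ j, rLahProb n k r j ≤ rLahProb n k r i) :
    k ≤ i ∧ i ≤ n ∧ 0 < rStirlingFirst n i r ∧ 0 < rStirlingSecond i k r := by
  have hpos : 0 < rLahProb n k r i := by
    by_contra! h
    have h1 := sum_rLahProb hkn hr hkr
    have h2 := Finset.sum_nonpos fun j (_ : j ∈ Finset.Icc k n) => (hi j).trans h
    linarith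
  rw [rLahProb] at hpos
  split_ifs at hpos with hmem
  · obtain ⟨h1, h2⟩ := Finset.mem_Icc.1 hmem
    refine ⟨h1, h2, (rStirlingFirst_nonneg n i hr).lt_of_ne' ?_,
      (rStirlingSecond_nonneg i k hr).lt_of_ne' ?_⟩ <;> rintro h0 <;> simp [h0] at hpos
  · exact absurd hpos (lt_irrefl 0)

theorem rLahProb_le_iff {k n i j : ℕ} {r : ℝ} (hr : 0 ≤ r) (hkr : 0 < max (k : ℝ) r)
    (hi : i ∈ Finset.Icc k n) (hj : j ∈ Finset.Icc k n) :
    rLahProb n k r i ≤ rLahProb n k r j ↔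
      rStirlingFirst n i r * rStirlingSecond i k r
        ≤ rStirlingFirst n j r * rStirlingSecond j k r := by
  have hkn : k ≤ n := (Finset.mem_Icc.1 hi).1.trans (Finset.mem_Icc.1 hi).2
  rw [rLahProb, rLahProb, if_pos hi, if_pos hj, div_le_div_iff_of_pos_right (rLah_pos hkn hr hkr)]

theorem mainTheorem10 (k : ℕ) (r : ℝ) (hr : 0 ≤ r) (hkr : 0 < max (k : ℝ) r) :
    ∃ N : ℕ, ∀ n : ℕ, N < n → ∀ i : ℕ,
      (∀ j : ℕ, rLahProb n k r j ≤ rLahProb n k r i) →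
        (i : ℤ) = ⌊((k : ℝ) + r) * Real.log (n : ℝ)
            - ((k : ℝ) + r) * deriv Real.Gamma ((k : ℝ) + 2 * r) / Real.Gamma ((k : ℝ) + 2 * r)
            - 1 / 2⌋ ∨
        (i : ℤ) = ⌈((k : ℝ) + r) * Real.log (n : ℝ)
            - ((k : ℝ) + r) * deriv Real.Gamma ((k : ℝ) + 2 * r) / Real.Gamma ((k : ℝ) + 2 * r)
            - 1 / 2⌉ := by
  have hk0 : (0 : ℝ) ≤ k := k.cast_nonneg
  have hq : 0 < (k : ℝ) + r := by
    rcases lt_max_iff.1 hkr with h | h <;> linarith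
  set q := (k : ℝ) + r with hqdef
  obtain ⟨ε, hε, hε', hS⟩ := exists_rStirlingSecond_succ_le k hr
  have hlim : Tendsto (fun n : ℕ => ∑ m ∈ Finset.range n, 1 / (r + m + q) - Real.log n) atTop
      (𝓝 (-(deriv Real.Gamma ((k : ℝ) + 2 * r) / Real.Gamma ((k : ℝ) + 2 * r)))) := by
    refine (tendsto_sum_inv_sub_log (x := (k : ℝ) + 2 * r) (by linarith)).congr fun n => ?_
    congr 1
    refine Finset.sum_congr rfl fun m _ => ?_
    rw [hqdef]
    ring
  have hlog : Tendsto (fun n : ℕ => Real.log n) atTop atTop :=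
    Real.tendsto_log_atTop.comp tendsto_natCast_atTop_atTop
  have hH : Tendsto (fun n : ℕ => ∑ m ∈ Finset.range n, 1 / (r + m + q)) atTop atTop :=
    (hlim.add_atTop hlog).congr fun n => sub_add_cancel _ _
  have hclose := (hlim.const_mul q).eventually (Metric.ball_mem_nhds _ (show (0 : ℝ) < 1 / 8 by
    norm_num))
  obtain ⟨N, hN⟩ := eventually_atTop.1 ((hclose.and
    (eventually_add_mul_coeff_succ_lt hr hq hε hε' hH)).and
    ((hH.eventually_ge_atTop (((k : ℝ) + 3) / q)).and (eventually_ge_atTop k)))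
  refine ⟨N, fun n hn i hi => ?_⟩
  obtain ⟨⟨hdist, habove⟩, hbig, hkn⟩ := hN n hn.le
  set ψ := deriv Real.Gamma ((k : ℝ) + 2 * r) / Real.Gamma ((k : ℝ) + 2 * r) with hψ
  rw [mul_div_assoc, ← hψ]
  set u := q * Real.log n - q * ψ - 1 / 2 with hu
  set H := ∑ m ∈ Finset.range n, 1 / (r + m + q) with hHdef
  rw [Real.dist_eq, abs_lt] at hdist
  rw [div_le_iff₀ hq] at hbig
  have hu₁ : u ≤ q * H - 3 / 8 := by linarith [hdist.1]
  have hu₂ : q * H - 5 / 8 ≤ u := by linarith [hdist.2]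
  obtain ⟨hki, hin, hai, hSi⟩ := pos_of_forall_rLahProb_le hkn hr hkr hi
  have hw : ∀ m : ℕ, 0 ≤ r + (m : ℝ) := fun m => by positivity
  -- Comparing with `i + 1` gives `q * H ≤ i + 1`, while `u ≤ q * H - 3/8`.
  have hlow : u - 1 < i := by
    by_contra! h
    have hqH := mul_sum_inv_add_le hr hq n
    have hin' : i + 1 ≤ n := by
      have : (i : ℝ) + 1 ≤ n := by linarith
      exact_mod_cast this
    have h1 := (rLahProb_le_iff hr hkr (Finset.mem_Icc.2 ⟨by omega, hin'⟩)
      (Finset.mem_Icc.2 ⟨hki, hin⟩)).1 (hi (i + 1))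
    have hai' := rStirlingFirst_pos hr (by omega) hin'
    have h2 := mul_le_mul_of_nonneg_left (mul_rStirlingSecond_le_succ i k hr) hai'.le
    have h3 : q * rStirlingFirst n (i + 1) r ≤ rStirlingFirst n i r := by
      refine le_of_mul_le_mul_right ?_ hSi
      linarith
    rw [← coeff_linProd_range] at hai'
    rw [← coeff_linProd_range, ← coeff_linProd_range] at h3
    have h4 := sum_div_le_of_mul_coeff_succ_le hw hq hai' h3
    linarith
  -- Otherwise `j = i - 1 ≥ u ≥ q * H - 5/8`, and `j` has strictly larger probability than `i`.
  have hupp : (i : ℝ) < u + 1 := by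
    by_contra! h
    have hik : k + 1 < i := by
      have : (k : ℝ) + 1 < i := by linarith
      exact_mod_cast this
    obtain ⟨j, rfl⟩ : ∃ j, i = j + 1 := ⟨i - 1, by omega⟩
    push_cast at h
    have haj := rStirlingFirst_pos (n := n) (i := j) hr (by omega) (by omega)
    have h1 := habove j (by linarith) haj hai
    have h2 := (rLahProb_le_iff hr hkr (Finset.mem_Icc.2 ⟨by omega, by omega⟩)
      (Finset.mem_Icc.2 ⟨hki, hin⟩)).1 (hi j)
    have h3 := mul_le_mul_of_nonneg_left (hS j (by omega)) hai.le
    have hSj : 0 < rStirlingSecond j k r := by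
      refine (rStirlingSecond_nonneg j k hr).lt_of_ne' fun h0 => ?_
      have := hS j (by omega)
      rw [h0, mul_zero] at this
      linarith
    have h4 := mul_lt_mul_of_pos_right h1 hSj
    linarith
  rcases le_or_gt (i : ℝ) u with h | h
  · left
    symm
    rw [Int.floor_eq_iff]
    push_cast
    exact ⟨h, by linarith⟩
  · right
    symm
    rw [Int.ceil_eq_iff]
    push_cast
    exact ⟨by linarith, h.le⟩
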